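/- **Local tomography.** Names. Let $\mathbb K$ be a countable set and let $-\mathbb K$ be a disjoint copy of it. For a set $C$, let $\mathcal N[C]$ be the algebra of terms $u,v ::= c \mid u.l \mid u.r \mid u\lor v$ ($c\in C$) modulo the congruence generated by $(u\lor v).l=u$, $(u\lor v).r=v$, $u.l\lor u.r=u$; for a word $t\in\{l,r\}^*$ write $u.t$ for the result of applying its letters to $u$ from left to right. Put $\mathcal V:=\mathcal N[\mathbb K\cup -\mathbb K]$. For $V\subseteq\mathcal V$ let $\mathcal N[V]\subseteq\mathcal V$ be the set of names generated by $V$ under $.l$, $.r$ and $\lor$, and write $V\mathrel{\hat=}V'$ if $\mathcal N[V]=\mathcal N[V']$. Graphs. Let $\Sigma$ be a set. A graph is a finite set $G\subseteq\Sigma\times\mathcal V$ such that $(s,v),(s',v')\in G$ and $v.t=v'.t'$ imply $s=s'$, $v=v'$ and $t=t'$. Let $\mathcal G$ be the set of graphs, $V(G):=\{v \mid \exists s,\ (s,v)\in G\}$, and $\mathcal H:=\ell^2(\mathcal G)$ with canonical orthonormal basis $(|G\rangle)_{G\in\mathcal G}$. A restriction is a map $\chi:\mathcal G\to\mathcal G$,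 $G\mapsto G_\chi\subseteq G$, such that $G_\chi\subseteq H\subseteq G$ implies $H_\chi=G_\chi$; write $G_{\overline\chi}:=G\setminus G_\chi$. Operators. A bounded operator $A$ on $\mathcal H$ is *$\chi$-local* if $\langle H|A|G\rangle=\langle H_\chi|A|G_\chi\rangle\,\langle H_{\overline\chi}|G_{\overline\chi}\rangle$ for all $G,H\in\mathcal G$, and *name-preserving* if $\langle H|A|G\rangle=0$ whenever $V(G)\mathrel{\hat=}V(H)$ fails. For a trace-class operator $\rho$ on $\mathcal H$ the partial trace is $$\rho_{|\chi}:=\sum_{G,H\in\mathcal G}\langle G|\rho|H\rangle\,\langle H_{\overline\chi}|G_{\overline\chi}\rangle\,|G_\chi\rangle\langle H_\chi| .$$ Statement. Let $\chi$ be a restriction and let $\rho,\sigma$ be trace-class operators on $\mathcal H$. The series defining $\rho_{|\chi}$ and $\sigma_{|\chi}$ converge unconditionally in operator norm, and: 1. If $\operatorname{Tr}(A\rho)=\operatorname{Tr}(A\sigma)$ for all bounded $\chi$-local operators $A$, then $\rho_{|\chi}=\sigma_{|\chi}$. 2. If $\rho$ and $\sigma$ are name-preserving and $\operatorname{Tr}(A\rho)=\operatorname{Tr}(A\sigma)$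 for all bounded operators $A$ that are both $\chi$-local and name-preserving, then $\rho_{|\chi}=\sigma_{|\chi}$. -/

import Mathlib

/-! ### The name algebra -/

/-- The two letters of the words that act on names. -/
inductive Side : Type
  | l
  | r

/-- Terms of the name algebra over the set of atoms `C`: atoms, `u.l`, `u.r` and `u ∨ v`.
The term `u.t` for a word `t` is obtained letter by letter, see `Name.dots`. -/
inductive NameTerm (C : Type*) : Type _
  | atom (c : C) : NameTerm C
  | dot (u : NameTerm C) (s : Side) : NameTerm C
  | join (u v : NameTerm C) : NameTerm C

/-- The equality theory of the name algebra: the least congruence with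
`(u ∨ v).l = u`, `(u ∨ v).r = v` and `u.l ∨ u.r = u`. -/
inductive NameTerm.Eqv {C : Type*} : NameTerm C → NameTerm C → Prop
  | join_l (u v : NameTerm C) : Eqv (.dot (.join u v) .l) u
  | join_r (u v : NameTerm C) : Eqv (.dot (.join u v) .r) v
  | join_eta (u : NameTerm C) : Eqv (.join (.dot u .l) (.dot u .r)) u
  | congr_dot {u u' : NameTerm C} (s : Side) : Eqv u u' → Eqv (.dot u s) (.dot u' s)
  | congr_join {u u' v v' : NameTerm C} :
      Eqv u u' → Eqv v v' → Eqv (.join u v) (.join u' v')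
  | refl (u : NameTerm C) : Eqv u u
  | symm {u v : NameTerm C} : Eqv u v → Eqv v u
  | trans {u v w : NameTerm C} : Eqv u v → Eqv v w → Eqv u w

/-- Terms modulo the equality theory. -/
instance NameTerm.setoid (C : Type*) : Setoid (NameTerm C) where
  r := NameTerm.Eqv
  iseqv := ⟨.refl, .symm, .trans⟩

/-- The name algebra `𝒩[C]`. -/
def Name (C : Type*) : Type _ := Quotient (NameTerm.setoid C)

namespace Name

variable {C : Type*}

/-- The atom `c`, as a name. -/
def atom (c : C) : Name C := Quotient.mk _ (.atom c)

/-- `u.s` for a single letter `s`. -/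
def dot (u : Name C) (s : Side) : Name C :=
  Quotient.map (fun u => NameTerm.dot u s) (fun _ _ h => NameTerm.Eqv.congr_dot s h) u

/-- `u ∨ v`. -/
def join (u v : Name C) : Name C :=
  Quotient.map₂ NameTerm.join (fun _ _ h _ _ h' => NameTerm.Eqv.congr_join h h') u v

/-- `u.t` for a word `t`, read from left to right; in particular `u.ε = u`. -/
def dots (u : Name C) (t : List Side) : Name C := t.foldl dot u

/-- `𝒩[V]` for a set `V` of names: the names given by terms over `V`. -/
inductive Gen (V : Set (Name C)) : Name C → Prop
  | of {v : Name C} : v ∈ V → Gen V v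
  | dot {u : Name C} (s : Side) : Gen V u → Gen V (u.dot s)
  | join {u v : Name C} : Gen V u → Gen V v → Gen V (u.join v)

/-- `V ≙ V'`, that is `𝒩[V] = 𝒩[V']`. -/
def Corresponds (V V' : Set (Name C)) : Prop := {u | Gen V u} = {u | Gen V' u}

end Name

/-- The set `𝒱 = 𝒩[K ∪ -K]` of vertices; `Sum.inr c` is the atom `-c`. -/
abbrev Vertex (K : Type*) : Type _ := Name (K ⊕ K)

/-! ### Graphs -/

/-- A graph: a finite set of systems (pairs of an internal state and a vertex) that is
well-named. -/
@[ext]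
structure NamedGraph (K S : Type*) where
  systems : Finset (S × Vertex K)
  wellNamed : ∀ a ∈ systems, ∀ b ∈ systems, ∀ t t' : List Side,
    a.2.dots t = b.2.dots t' → a = b ∧ t = t'

namespace NamedGraph

variable {K S : Type*}

/-- The support `V(G)`. -/
def support (G : NamedGraph K S) : Set (Vertex K) := {v | ∃ s, (s, v) ∈ G.systems}

/-- The graph `G \ H`. -/
noncomputable def diff (G H : NamedGraph K S) : NamedGraph K S where
  systems := by classical exact G.systems \ H.systems
  wellNamed a ha b hb := by
    classical
    exact G.wellNamed a (Finset.mem_sdiff.1 ha).1 b (Finset.mem_sdiff.1 hb).1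

end NamedGraph

/-- A restriction `χ : G ↦ G_χ ⊆ G`. -/
structure Restriction (K S : Type*) where
  res : NamedGraph K S → NamedGraph K S
  res_subset : ∀ G, (res G).systems ⊆ G.systems
  res_eq : ∀ G H : NamedGraph K S, (res G).systems ⊆ H.systems → H.systems ⊆ G.systems →
    res H = res G

/-- `G_χ̄ = G \ G_χ`. -/
noncomputable def Restriction.compl {K S : Type*} (χ : Restriction K S) (G : NamedGraph K S) : NamedGraph K S :=
  G.diff (χ.res G)

/-! ### The Hilbert space of graphs and its operators -/

/-- The Hilbert space `ℋ` with canonical orthonormal basis labelled by the graphs. -/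
abbrev NetSpace (K S : Type*) : Type _ := lp (fun _ : NamedGraph K S => ℂ) 2

/-- Bounded operators on `ℋ`. -/
abbrev NetOp (K S : Type*) : Type _ := NetSpace K S →L[ℂ] NetSpace K S

noncomputable section

variable {K S : Type*}

/-- The basis vector `|G⟩`. -/
def ket (G : NamedGraph K S) : NetSpace K S := by
  classical exact lp.single 2 G (1 : ℂ)

/-- The matrix element `⟨G|A|H⟩`. -/
def matElem (A : NetOp K S) (G H : NamedGraph K S) : ℂ := inner ℂ (ket G) (A (ket H))

/-- The trace `Tr T = ∑_G ⟨G|T|G⟩`, also written `T_{|∅}`. -/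
def opTrace (T : NetOp K S) : ℂ := ∑' G, matElem T G G

/-- The absolute value `|T| = (T† T)^{1/2}` of a bounded operator on a Hilbert space. -/
def opAbs {E : Type*} [NormedAddCommGroup E] [InnerProductSpace ℂ E] [CompleteSpace E]
    (T : E →L[ℂ] E) : E →L[ℂ] E := CFC.abs T

/-- `ρ` is trace class: `Tr |ρ| < ∞`. -/
def IsTraceClass (ρ : NetOp K S) : Prop := Summable fun G => matElem (opAbs ρ) G G

/-- Name-preservation: `⟨H|A|G⟩ = 0` unless `V(G) ≙ V(H)`. -/
def NamePreserving (A : NetOp K S) : Prop :=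
  ∀ G H : NamedGraph K S, ¬ Name.Corresponds G.support H.support → matElem A H G = 0

/-- `χ`-locality: `⟨H|A|G⟩ = ⟨H_χ|A|G_χ⟩ ⟨H_χ̄|G_χ̄⟩`. -/
def IsLocal (χ : Restriction K S) (A : NetOp K S) : Prop :=
  ∀ G H : NamedGraph K S, matElem A H G =
    matElem A (χ.res H) (χ.res G) * inner ℂ (ket (χ.compl H)) (ket (χ.compl G))

/-- `(|G⟩⟨H|)_{|χ} = ⟨H_χ̄|G_χ̄⟩ |G_χ⟩⟨H_χ|`. -/
def ketBraTrace (χ : Restriction K S) (G H : NamedGraph K S) : NetOp K S :=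
  (inner ℂ (ket (χ.compl H)) (ket (χ.compl G)) : ℂ) •
    InnerProductSpace.rankOne ℂ (ket (χ.res G)) (ket (χ.res H))

/-- The terms `⟨G|ρ|H⟩ (|G⟩⟨H|)_{|χ}` of the linear extension of `(·)_{|χ}`. -/
def partialTraceTerm (χ : Restriction K S) (ρ : NetOp K S) (p : NamedGraph K S × NamedGraph K S) :
    NetOp K S :=
  matElem ρ p.1 p.2 • ketBraTrace χ p.1 p.2

/-- The partial trace `ρ_{|χ}`; the series converges in operator norm for trace class `ρ`. -/
def partialTrace (χ : Restriction K S) (ρ : NetOp K S) : NetOp K S :=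
  ∑' p, partialTraceTerm χ ρ p

end

/-! ### Names generated by a well-named set -/

namespace Name

variable {C : Type*}

theorem join_dot_l (u v : Name C) : (u.join v).dot .l = u := by
  induction u, v using Quotient.inductionOn₂
  exact Quotient.sound (NameTerm.Eqv.join_l _ _)

theorem join_dot_r (u v : Name C) : (u.join v).dot .r = v := by
  induction u, v using Quotient.inductionOn₂
  exact Quotient.sound (NameTerm.Eqv.join_r _ _)

theorem join_dot_dot (u : Name C) : (u.dot .l).join (u.dot .r) = u := by
  induction u using Quotient.inductionOn
  exact Quotient.sound (NameTerm.Eqv.join_eta _)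

theorem dots_cons (u : Name C) (s : Side) (t : List Side) : u.dots (s :: t) = (u.dot s).dots t :=
  rfl

namespace Gen

theorem dots {V : Set (Name C)} {u : Name C} (h : Gen V u) (t : List Side) : Gen V (u.dots t) := by
  induction t generalizing u with
  | nil => exact h
  | cons s t ih => exact ih (h.dot s)

theorem trans {V W : Set (Name C)} (h : ∀ v ∈ V, Gen W v) {u : Name C} (hu : Gen V u) :
    Gen W u := by
  induction hu with
  | of hv => exact h _ hv
  | dot s _ ih => exact ih.dot s
  | join _ _ ih ih' => exact ih.join ih'

theorem mono {V W : Set (Name C)} (h : V ⊆ W) {u : Name C} (hu : Gen V u) : Gen W u :=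
  hu.trans fun _ hv => .of (h hv)

/-- Every sufficiently deep descendant of a generated name descends from a generator. -/
theorem exists_dots_eq {V : Set (Name C)} {u : Name C} (h : Gen V u) :
    ∃ n : ℕ, ∀ t : List Side, n ≤ t.length → ∃ v ∈ V, ∃ t', u.dots t = v.dots t' := by
  induction h with
  | of hv => exact ⟨0, fun t _ => ⟨_, hv, t, rfl⟩⟩
  | dot s _ ih =>
    obtain ⟨n, hn⟩ := ih
    exact ⟨n, fun t ht => hn (s :: t) (ht.trans (Nat.le_succ _))⟩
  | join _ _ ih ih' =>
    obtain ⟨n, hn⟩ := ih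
    obtain ⟨m, hm⟩ := ih'
    refine ⟨max n m + 1, fun t ht => ?_⟩
    match t, ht with
    | .l :: t, ht =>
      rw [dots_cons, join_dot_l]
      exact hn t ((le_max_left n m).trans (Nat.le_of_succ_le_succ ht))
    | .r :: t, ht =>
      rw [dots_cons, join_dot_r]
      exact hm t ((le_max_right n m).trans (Nat.le_of_succ_le_succ ht))

theorem of_forall_dots {V : Set (Name C)} (n : ℕ) {u : Name C}
    (h : ∀ t : List Side, t.length = n → Gen V (u.dots t)) : Gen V u := by
  induction n generalizing u with
  | zero => exact h [] rfl
  | succ n ih =>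
    rw [← join_dot_dot u]
    exact (ih fun t ht => h (.l :: t) (by simp [ht])).join
      (ih fun t ht => h (.r :: t) (by simp [ht]))

/-- A generator whose descendants avoid those of a given element is superfluous. -/
theorem of_union {V W : Set (Name C)} {u : Name C} (h : Gen (V ∪ W) u)
    (hW : ∀ w ∈ W, ∀ t t' : List Side, u.dots t ≠ w.dots t') : Gen V u := by
  obtain ⟨n, hn⟩ := h.exists_dots_eq
  refine of_forall_dots n fun t ht => ?_
  obtain ⟨v, hv | hv, t', h'⟩ := hn t ht.ge
  · rw [h']
    exact (Gen.of hv).dots t'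
  · exact absurd h' (hW v hv t t')

end Gen

theorem corresponds_iff {V W : Set (Name C)} :
    Corresponds V W ↔ (∀ v ∈ V, Gen W v) ∧ ∀ w ∈ W, Gen V w := by
  constructor
  · intro h
    exact ⟨fun v hv => h.le (Gen.of hv), fun w hw => h.ge (Gen.of hw)⟩
  · rintro ⟨h, h'⟩
    exact Set.Subset.antisymm (fun _ hu => Gen.trans h hu) fun _ hu => Gen.trans h' hu

theorem Corresponds.symm {V W : Set (Name C)} (h : Corresponds V W) : Corresponds W V :=
  Eq.symm h

theorem Corresponds.union_right {V V' : Set (Name C)} (h : Corresponds V V') (W : Set (Name C)) :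
    Corresponds (V ∪ W) (V' ∪ W) := by
  obtain ⟨h₁, h₂⟩ := corresponds_iff.1 h
  refine corresponds_iff.2 ⟨?_, ?_⟩
  · rintro v (hv | hv)
    exacts [(h₁ v hv).mono Set.subset_union_left, .of (.inr hv)]
  · rintro v (hv | hv)
    exacts [(h₂ v hv).mono Set.subset_union_left, .of (.inr hv)]

theorem Corresponds.of_union_right {V V' W : Set (Name C)} (h : Corresponds (V ∪ W) (V' ∪ W))
    (hV : ∀ v ∈ V, ∀ w ∈ W, ∀ t t' : List Side, v.dots t ≠ w.dots t')
    (hV' : ∀ v ∈ V', ∀ w ∈ W, ∀ t t' : List Side, v.dots t ≠ w.dots t') : Corresponds V V' := by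
  obtain ⟨h₁, h₂⟩ := corresponds_iff.1 h
  exact corresponds_iff.2 ⟨fun v hv => (h₁ v (.inl hv)).of_union (hV v hv),
    fun v hv => (h₂ v (.inl hv)).of_union (hV' v hv)⟩

end Name

/-! ### A graph and its restriction -/

namespace Restriction

variable {K S : Type*} (χ : Restriction K S)

theorem mem_compl {G : NamedGraph K S} {a : S × Vertex K} :
    a ∈ (χ.compl G).systems ↔ a ∈ G.systems ∧ a ∉ (χ.res G).systems := by
  classical
  simp [compl, NamedGraph.diff]

theorem res_res (G : NamedGraph K S) : χ.res (χ.res G) = χ.res G :=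
  χ.res_eq G (χ.res G) subset_rfl (χ.res_subset G)

theorem compl_res_eq (G H : NamedGraph K S) : χ.compl (χ.res G) = χ.compl (χ.res H) := by
  ext a
  simp [mem_compl, res_res]

/-- A graph is determined by its restriction and the complement thereof. -/
theorem eq_of_res_eq_of_compl_eq {G H : NamedGraph K S} (h : χ.res G = χ.res H)
    (h' : χ.compl G = χ.compl H) : G = H := by
  have key : ∀ {G H : NamedGraph K S}, χ.res G = χ.res H → χ.compl G = χ.compl H →
      ∀ a ∈ G.systems, a ∈ H.systems := by
    intro G H h h' a ha
    by_cases hr : a ∈ (χ.res G).systems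
    · exact χ.res_subset H (h ▸ hr)
    · exact (χ.mem_compl.1 (h' ▸ χ.mem_compl.2 ⟨ha, hr⟩)).1
  ext a
  exact ⟨key h h' a, key h.symm h'.symm a⟩

theorem support_eq_union (G : NamedGraph K S) :
    G.support = (χ.res G).support ∪ (χ.compl G).support := by
  ext v
  constructor
  · rintro ⟨s, hs⟩
    by_cases hr : (s, v) ∈ (χ.res G).systems
    · exact .inl ⟨s, hr⟩
    · exact .inr ⟨s, χ.mem_compl.2 ⟨hs, hr⟩⟩
  · rintro (⟨s, hs⟩ | ⟨s, hs⟩)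
    · exact ⟨s, χ.res_subset G hs⟩
    · exact ⟨s, (χ.mem_compl.1 hs).1⟩

theorem dots_ne_dots (G : NamedGraph K S) (v : Vertex K) (hv : v ∈ (χ.res G).support)
    (w : Vertex K) (hw : w ∈ (χ.compl G).support) (t t' : List Side) : v.dots t ≠ w.dots t' := by
  obtain ⟨s, hs⟩ := hv
  obtain ⟨s', hs'⟩ := hw
  obtain ⟨hG, hr⟩ := χ.mem_compl.1 hs'
  intro h
  have := (G.wellNamed _ (χ.res_subset G hs) _ hG t t' h).1
  exact hr (this ▸ hs)

/-- For two graphs with the same complement, the supports correspond if and only if those of the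
restrictions do. -/
theorem corresponds_support_iff {G H : NamedGraph K S} (h : χ.compl G = χ.compl H) :
    Name.Corresponds G.support H.support ↔
      Name.Corresponds (χ.res G).support (χ.res H).support := by
  rw [χ.support_eq_union G, χ.support_eq_union H, h]
  refine ⟨fun hc => hc.of_union_right ?_ (χ.dots_ne_dots H), fun hc => hc.union_right _⟩
  rw [← h]
  exact χ.dots_ne_dots G

end Restriction

/-! ### Factorization of operators on a Hilbert space -/

/-- An operator dominated pointwise in norm by `P` factors through `P` by a contraction. -/
theorem ContinuousLinearMap.exists_contraction_mul_eq {E : Type*} [NormedAddCommGroup E]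
    [InnerProductSpace ℂ E] [CompleteSpace E] (T P : E →L[ℂ] E) (h : ∀ x, ‖T x‖ ≤ ‖P x‖) :
    ∃ U : E →L[ℂ] E, (∀ x, ‖U x‖ ≤ ‖x‖) ∧ U * P = T := by
  let M : Submodule ℂ E := (LinearMap.range P.toLinearMap).topologicalClosure
  have hM : ∀ x, P x ∈ M := fun x => Submodule.le_topologicalClosure _ ⟨x, rfl⟩
  let e : E →ₗ[ℂ] M := P.toLinearMap.codRestrict M hM
  have hd : DenseRange e := by
    intro y
    rw [closure_subtype]
    refine closure_mono ?_ y.2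
    rintro _ ⟨x, rfl⟩
    exact ⟨e x, ⟨x, rfl⟩, rfl⟩
  have hn : ∀ x, ‖T.toLinearMap x‖ ≤ 1 * ‖e x‖ := fun x => by simpa using! h x
  have hc : IsClosed (M : Set E) := Submodule.isClosed_topologicalClosure _
  have : CompleteSpace M := hc.completeSpace_coe
  refine ⟨(T.toLinearMap.extendOfNorm e).comp M.orthogonalProjectionOnto, fun x => ?_, ?_⟩
  · calc _ ≤ 1 * ‖M.orthogonalProjectionOnto x‖ :=
          LinearMap.norm_extendOfNorm_apply_le hd 1 hn _
      _ ≤ ‖x‖ := by simpa using M.norm_orthogonalProjectionOnto_apply_le x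
  · ext1 x
    have : M.orthogonalProjectionOnto (P x) = e x :=
      M.orthogonalProjectionOnto_mem_subspace_eq_self ⟨P x, hM x⟩
    change T.toLinearMap.extendOfNorm e (M.orthogonalProjectionOnto (P x)) = T x
    rw [this]
    exact LinearMap.extendOfNorm_eq hd ⟨1, hn⟩ x

theorem norm_opAbs_apply {E : Type*} [NormedAddCommGroup E] [InnerProductSpace ℂ E]
    [CompleteSpace E] (T : E →L[ℂ] E) (x : E) : ‖opAbs T x‖ = ‖T x‖ := by
  have hsa : star (opAbs T) = opAbs T := (CFC.abs_nonneg T).isSelfAdjoint.star_eq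
  have hsq : star (opAbs T) * opAbs T = star T * T := by
    rw [hsa]
    exact CFC.abs_mul_abs T
  have key : ∀ A : E →L[ℂ] E, inner ℂ ((star A * A) x) x = (‖A x‖ ^ 2 : ℂ) := by
    intro A
    rw [mul_apply_eq_comp, ContinuousLinearMap.star_eq_adjoint,
      ContinuousLinearMap.adjoint_inner_left, inner_self_eq_norm_sq_to_K]
    rfl
  have := key (opAbs T)
  rw [hsq, key T] at this
  have h : ‖T x‖ ^ 2 = ‖opAbs T x‖ ^ 2 := by exact_mod_cast this
  exact ((sq_eq_sq₀ (norm_nonneg _) (norm_nonneg _)).1 h).symm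

theorem exists_mul_self_eq_opAbs {E : Type*} [NormedAddCommGroup E] [InnerProductSpace ℂ E]
    [CompleteSpace E] (T : E →L[ℂ] E) :
    ∃ R : E →L[ℂ] E, star R = R ∧ R * R = opAbs T :=
  ⟨CFC.sqrt (opAbs T), (CFC.sqrt_nonneg (opAbs T)).isSelfAdjoint.star_eq,
    CFC.sqrt_mul_sqrt_self _ (CFC.abs_nonneg T)⟩

/-! ### Matrix elements in the basis of graphs -/

section MatrixElements

variable {K S : Type*}

theorem inner_ket_left (G : NamedGraph K S) (x : NetSpace K S) : inner ℂ (ket G) x = x G := by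
  classical
  simp [ket, lp.inner_single_left]

theorem ket_apply_self (G : NamedGraph K S) : ket G G = 1 := by
  classical
  simp [ket]

theorem ket_apply_ne {G H : NamedGraph K S} (h : H ≠ G) : ket G H = 0 := by
  classical
  simp [ket, h]

theorem matElem_eq_apply (A : NetOp K S) (G H : NamedGraph K S) : matElem A G H = A (ket H) G :=
  inner_ket_left _ _

theorem inner_ket_ket [DecidableEq (NamedGraph K S)] (G H : NamedGraph K S) :
    inner ℂ (ket G) (ket H) = if G = H then 1 else 0 := by
  rw [inner_ket_left]
  split_ifs with h
  · rw [h, ket_apply_self]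
  · exact ket_apply_ne h

theorem NetSpace.hasSum_norm_sq (x : NetSpace K S) :
    HasSum (fun G => ‖x G‖ ^ 2) (‖x‖ ^ 2) := by
  simpa using lp.hasSum_norm (p := 2) (by norm_num) x

theorem NetSpace.sum_norm_sq_le (x : NetSpace K S) (s : Finset (NamedGraph K S)) :
    ∑ G ∈ s, ‖x G‖ ^ 2 ≤ ‖x‖ ^ 2 :=
  sum_le_hasSum s (fun _ _ => by positivity) x.hasSum_norm_sq

theorem NetOp.ext_matElem {A B : NetOp K S} (h : ∀ G H, matElem A G H = matElem B G H) :
    A = B := by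
  classical
  refine lp.ext_continuousLinearMap ENNReal.ofNat_ne_top fun G => ?_
  ext1
  refine lp.ext (funext fun H => ?_)
  have := h H G
  rw [matElem_eq_apply, matElem_eq_apply] at this
  simpa [ket] using this

theorem NetOp.adjoint_ket_apply (T : NetOp K S) (G H : NamedGraph K S) :
    star T (ket G) H = starRingEnd ℂ (T (ket H) G) := by
  rw [← inner_ket_left, ContinuousLinearMap.star_eq_adjoint,
    ContinuousLinearMap.adjoint_inner_right, ← inner_conj_symm, inner_ket_left]

/-- The adjoint of a Hilbert–Schmidt operator is Hilbert–Schmidt. -/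
theorem NetOp.summable_norm_sq_adjoint {T : NetOp K S}
    (hT : Summable fun G => ‖T (ket G)‖ ^ 2) : Summable fun G => ‖star T (ket G)‖ ^ 2 := by
  have h : Summable fun p : NamedGraph K S × NamedGraph K S => ‖T (ket p.1) p.2‖ ^ 2 := by
    refine (summable_prod_of_nonneg fun _ => by positivity).2
      ⟨fun G => (T (ket G)).hasSum_norm_sq.summable, ?_⟩
    simpa only [(NetSpace.hasSum_norm_sq _).tsum_eq] using hT
  refine h.prod_symm.prod.congr fun G => ?_
  rw [← (NetSpace.hasSum_norm_sq _).tsum_eq]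
  simp [NetOp.adjoint_ket_apply]

/-- The matrix of a trace-class operator is dominated by a product of square-summable weights. -/
theorem IsTraceClass.exists_weights {ρ : NetOp K S} (hρ : IsTraceClass ρ) :
    ∃ β γ : NamedGraph K S → ℝ,
      (Summable fun G => β G ^ 2) ∧ (Summable fun G => γ G ^ 2) ∧
        ∀ G H, ‖matElem ρ G H‖ ≤ β G * γ H := by
  obtain ⟨U, hU, hUρ⟩ := ContinuousLinearMap.exists_contraction_mul_eq ρ (opAbs ρ)
    fun x => (norm_opAbs_apply ρ x).ge
  obtain ⟨R, hR, hRR⟩ := exists_mul_self_eq_opAbs ρ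
  have hγ : Summable fun G => ‖R (ket G)‖ ^ 2 := by
    have h : ∀ G, matElem (opAbs ρ) G G = ((‖R (ket G)‖ ^ 2 : ℝ) : ℂ) := by
      intro G
      have : matElem (star R * R) G G = ((‖R (ket G)‖ ^ 2 : ℝ) : ℂ) := by
        rw [matElem, mul_apply_eq_comp, ContinuousLinearMap.star_eq_adjoint,
          ContinuousLinearMap.adjoint_inner_right, inner_self_eq_norm_sq_to_K]
        push_cast
        rfl
      rw [← this, hR, hRR]
    have := hρ
    simp only [IsTraceClass, h] at this
    exact Complex.summable_ofReal.1 this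
  have hβ : Summable fun G => ‖star (U * R) (ket G)‖ ^ 2 := by
    refine NetOp.summable_norm_sq_adjoint (hγ.of_nonneg_of_le (fun _ => by positivity) fun G => ?_)
    gcongr
    exact hU _
  refine ⟨_, _, hβ, hγ, fun G H => ?_⟩
  have : matElem ρ G H = inner ℂ (star (U * R) (ket G)) (R (ket H)) := by
    rw [ContinuousLinearMap.star_eq_adjoint, ContinuousLinearMap.adjoint_inner_left,
      ← mul_apply_eq_comp, mul_assoc, hRR, hUρ, matElem]
  rw [this]
  exact norm_inner_le_norm _ _

/-! ### Convergence of the partial trace -/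

theorem sum_weight_mul_norm_sq_le {ι : Type*} [DecidableEq (NamedGraph K S)] (F : Finset ι)
    (a r : ι → NamedGraph K S)
    (hinj : ∀ i ∈ F, ∀ j ∈ F, a i = a j → r i = r j → i = j) (β : NamedGraph K S → ℝ)
    (x : NetSpace K S) :
    ∑ i ∈ F, (β (a i) * ‖x (r i)‖) ^ 2 ≤ (∑ G ∈ F.image a, β G ^ 2) * ‖x‖ ^ 2 := by
  rw [← Finset.sum_fiberwise_of_maps_to (fun i hi => Finset.mem_image_of_mem a hi),
    Finset.sum_mul]
  refine Finset.sum_le_sum fun G _ => ?_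
  have hi : Set.InjOn r (F.filter fun i => a i = G) := by
    intro i hi j hj h
    simp only [Finset.coe_filter, Set.mem_ofPred_eq] at hi hj
    exact hinj i hi.1 j hj.1 (hi.2.trans hj.2.symm) h
  calc ∑ i ∈ F with a i = G, (β (a i) * ‖x (r i)‖) ^ 2
      = β G ^ 2 * ∑ i ∈ F with a i = G, ‖x (r i)‖ ^ 2 := by
        rw [Finset.mul_sum]
        refine Finset.sum_congr rfl fun i hi => ?_
        rw [(Finset.mem_filter.1 hi).2, mul_pow]
    _ = β G ^ 2 * ∑ H ∈ (F.filter fun i => a i = G).image r, ‖x H‖ ^ 2 := by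
        rw [Finset.sum_image hi]
    _ ≤ β G ^ 2 * ‖x‖ ^ 2 := by
        gcongr
        exact x.sum_norm_sq_le _

theorem inner_partialTraceTerm [DecidableEq (NamedGraph K S)] (χ : Restriction K S)
    (ρ : NetOp K S) (p : NamedGraph K S × NamedGraph K S) (x y : NetSpace K S) :
    inner ℂ y (partialTraceTerm χ ρ p x) =
      if χ.compl p.2 = χ.compl p.1 then
        matElem ρ p.1 p.2 * (x (χ.res p.2) * starRingEnd ℂ (y (χ.res p.1))) else 0 := by
  have h : inner ℂ y (ket (χ.res p.1)) = starRingEnd ℂ (y (χ.res p.1)) := by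
    rw [← inner_conj_symm, inner_ket_left]
  simp only [partialTraceTerm, ketBraTrace, inner_ket_ket (χ.compl p.2), smul_apply,
    InnerProductSpace.rankOne_apply, inner_smul_right, inner_ket_left _ x, h]
  split_ifs <;> simp

theorem norm_sum_partialTraceTerm_le [DecidableEq (NamedGraph K S)] (χ : Restriction K S)
    (ρ : NetOp K S) {β γ : NamedGraph K S → ℝ}
    (hρ : ∀ G H, ‖matElem ρ G H‖ ≤ β G * γ H) (F : Finset (NamedGraph K S × NamedGraph K S)) :
    ‖∑ p ∈ F, partialTraceTerm χ ρ p‖ ≤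
      √(∑ G ∈ F.image Prod.fst, β G ^ 2) * √(∑ H ∈ F.image Prod.snd, γ H ^ 2) := by
  refine ContinuousLinearMap.opNorm_le_of_re_inner_le (𝕜 := ℂ) (by positivity)
    fun x y hx hy => ?_
  let D := F.filter fun p => χ.compl p.2 = χ.compl p.1
  have hD : D ⊆ F := Finset.filter_subset _ _
  have hfst : ∑ p ∈ D, (β p.1 * ‖x (χ.res p.2)‖) ^ 2 ≤ ∑ G ∈ F.image Prod.fst, β G ^ 2 := by
    refine (sum_weight_mul_norm_sq_le D Prod.fst (fun p => χ.res p.2) ?_ β x).trans ?_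
    · intro p hp q hq h h'
      have hp := (Finset.mem_filter.1 hp).2
      have hq := (Finset.mem_filter.1 hq).2
      exact Prod.ext h (χ.eq_of_res_eq_of_compl_eq h' (by rw [hp, hq, h]))
    · rw [hx, one_pow, mul_one]
      exact Finset.sum_le_sum_of_subset_of_nonneg (Finset.image_subset_image hD)
        fun _ _ _ => by positivity
  have hsnd : ∑ p ∈ D, (γ p.2 * ‖y (χ.res p.1)‖) ^ 2 ≤ ∑ H ∈ F.image Prod.snd, γ H ^ 2 := by
    refine (sum_weight_mul_norm_sq_le D Prod.snd (fun p => χ.res p.1) ?_ γ y).trans ?_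
    · intro p hp q hq h h'
      have hp := (Finset.mem_filter.1 hp).2
      have hq := (Finset.mem_filter.1 hq).2
      exact Prod.ext (χ.eq_of_res_eq_of_compl_eq h' (by rw [← hp, ← hq, h])) h
    · rw [hy, one_pow, mul_one]
      exact Finset.sum_le_sum_of_subset_of_nonneg (Finset.image_subset_image hD)
        fun _ _ _ => by positivity
  calc RCLike.re (inner ℂ ((∑ p ∈ F, partialTraceTerm χ ρ p) x) y)
      ≤ ‖inner ℂ ((∑ p ∈ F, partialTraceTerm χ ρ p) x) y‖ := RCLike.re_le_norm _
    _ = ‖∑ p ∈ D, matElem ρ p.1 p.2 * (x (χ.res p.2) * starRingEnd ℂ (y (χ.res p.1)))‖ := by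
        rw [norm_inner_symm, sum_apply, inner_sum, Finset.sum_filter]
        simp only [inner_partialTraceTerm]
    _ ≤ ∑ p ∈ D, (β p.1 * ‖x (χ.res p.2)‖) * (γ p.2 * ‖y (χ.res p.1)‖) := by
        refine norm_sum_le_of_le _ fun p _ => ?_
        rw [norm_mul, norm_mul, RCLike.norm_conj]
        calc _ ≤ (β p.1 * γ p.2) * (‖x (χ.res p.2)‖ * ‖y (χ.res p.1)‖) := by
              gcongr
              exact hρ _ _
          _ = _ := by ring
    _ ≤ √(∑ p ∈ D, (β p.1 * ‖x (χ.res p.2)‖) ^ 2) *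
          √(∑ p ∈ D, (γ p.2 * ‖y (χ.res p.1)‖) ^ 2) := Real.sum_mul_le_sqrt_mul_sqrt _ _ _
    _ ≤ _ := by gcongr

theorem exists_finset_sqrt_sum_sq_lt {ι : Type*} {f : ι → ℝ} (hf : Summable fun i => f i ^ 2)
    {ε : ℝ} (hε : 0 < ε) :
    ∃ s : Finset ι, ∀ t : Finset ι, Disjoint t s → √(∑ i ∈ t, f i ^ 2) < ε := by
  obtain ⟨s, hs⟩ := summable_iff_vanishing_norm.1 hf (ε ^ 2) (by positivity)
  refine ⟨s, fun t ht => ?_⟩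
  rw [Real.sqrt_lt' hε]
  exact (le_abs_self _).trans_lt (hs t ht)

theorem IsTraceClass.summable_partialTraceTerm (χ : Restriction K S) {ρ : NetOp K S}
    (hρ : IsTraceClass ρ) : Summable (partialTraceTerm χ ρ) := by
  classical
  obtain ⟨β, γ, hβs, hγs, hle⟩ := hρ.exists_weights
  refine summable_iff_vanishing_norm.2 fun ε hε => ?_
  have hbound : ∀ {f : NamedGraph K S → ℝ}, (Summable fun G => f G ^ 2) →
      ∀ t : Finset (NamedGraph K S), √(∑ G ∈ t, f G ^ 2) ≤ √(∑' G, f G ^ 2) :=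
    fun hf t => Real.sqrt_le_sqrt (hf.sum_le_tsum t fun _ _ => by positivity)
  let c := √(∑' G, β G ^ 2) + √(∑' G, γ G ^ 2) + 1
  have hc : 0 < c := by positivity
  obtain ⟨s, hs⟩ := exists_finset_sqrt_sum_sq_lt hβs (ε := ε / (2 * c)) (by positivity)
  obtain ⟨s', hs'⟩ := exists_finset_sqrt_sum_sq_lt hγs (ε := ε / (2 * c)) (by positivity)
  refine ⟨s ×ˢ s', fun t ht => ?_⟩
  rw [← Finset.sum_filter_add_sum_filter_not t (fun p => p.1 ∈ s)]
  refine (norm_add_le _ _).trans_lt ?_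
  have h₁ : ‖∑ p ∈ t with p.1 ∈ s, partialTraceTerm χ ρ p‖ ≤ c * (ε / (2 * c)) := by
    refine (norm_sum_partialTraceTerm_le χ ρ hle _).trans ?_
    gcongr
    · exact (hbound hβs _).trans (by simp only [c]; linarith [Real.sqrt_nonneg (∑' G, γ G ^ 2)])
    · refine (hs' _ (Finset.disjoint_left.2 fun H hH hH' => ?_)).le
      obtain ⟨p, hp, rfl⟩ := Finset.mem_image.1 hH
      obtain ⟨hp, hp'⟩ := Finset.mem_filter.1 hp
      exact Finset.disjoint_left.1 ht hp (Finset.mem_product.2 ⟨hp', hH'⟩)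
  have h₂ : ‖∑ p ∈ t with p.1 ∉ s, partialTraceTerm χ ρ p‖ < (ε / (2 * c)) * c := by
    refine (norm_sum_partialTraceTerm_le χ ρ hle _).trans_lt ?_
    refine mul_lt_mul'' (hs _ (Finset.disjoint_left.2 fun G hG hG' => ?_)) ?_
      (Real.sqrt_nonneg _) (Real.sqrt_nonneg _)
    · obtain ⟨p, hp, rfl⟩ := Finset.mem_image.1 hG
      exact (Finset.mem_filter.1 hp).2 hG'
    · exact (hbound hγs _).trans_lt
        (by simp only [c]; linarith [Real.sqrt_nonneg (∑' G, β G ^ 2)])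
  calc _ < c * (ε / (2 * c)) + ε / (2 * c) * c := add_lt_add_of_le_of_lt h₁ h₂
    _ = ε := by field_simp; ring

end MatrixElements

/-! ### Local tomography -/

section Tomography

variable {K S : Type*}

/-- The contraction `(A x) G = x (f G)` for `G ∈ D`, and `0` elsewhere, where `f` is injective
on `D`. -/
theorem NetOp.exists_of_injOn (D : Set (NamedGraph K S)) [DecidablePred (· ∈ D)]
    (f : NamedGraph K S → NamedGraph K S) (hf : Set.InjOn f D) :
    ∃ A : NetOp K S, ∀ x G, A x G = if G ∈ D then x (f G) else 0 := by
  classical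
  have hle : ∀ (x : NetSpace K S) (s : Finset (NamedGraph K S)),
      ∑ G ∈ s, ‖if G ∈ D then x (f G) else 0‖ ^ (2 : ENNReal).toReal ≤
        ‖x‖ ^ (2 : ENNReal).toReal := by
    intro x s
    have hi : Set.InjOn f (s.filter fun G => G ∈ D) := fun G hG H hH h =>
      hf (Finset.mem_filter.1 hG).2 (Finset.mem_filter.1 hH).2 h
    calc _ = ∑ G ∈ s with G ∈ D, ‖x (f G)‖ ^ 2 := by
          rw [Finset.sum_filter]
          refine Finset.sum_congr rfl fun G _ => ?_
          split_ifs <;> simp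
      _ = ∑ H ∈ (s.filter fun G => G ∈ D).image f, ‖x H‖ ^ 2 := by rw [Finset.sum_image hi]
      _ ≤ ‖x‖ ^ (2 : ENNReal).toReal := by simpa using x.sum_norm_sq_le _
  let L : NetSpace K S →ₗ[ℂ] NetSpace K S :=
    { toFun := fun x => ⟨fun G => if G ∈ D then x (f G) else 0, memℓp_gen' (hle x)⟩
      map_add' := fun x y => by
        refine lp.ext (funext fun G => ?_)
        change (if G ∈ D then x (f G) + y (f G) else 0) =
          (if G ∈ D then x (f G) else 0) + if G ∈ D then y (f G) else 0
        by_cases h : G ∈ D <;> simp [h]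
      map_smul' := fun c x => by
        refine lp.ext (funext fun G => ?_)
        by_cases h : G ∈ D <;> simp [h] }
  refine ⟨L.mkContinuous 1 fun x => ?_, fun x G => rfl⟩
  rw [one_mul]
  exact lp.norm_le_of_forall_sum_le (by norm_num) (norm_nonneg x) (hle x)

variable (χ : Restriction K S)

/-- Matrix elements of the partial trace. -/
theorem matElem_partialTrace [DecidableEq (NamedGraph K S)] {ρ : NetOp K S}
    (hρ : IsTraceClass ρ) (X Y : NamedGraph K S) :
    matElem (partialTrace χ ρ) X Y = ∑' p : NamedGraph K S × NamedGraph K S,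
      if χ.compl p.2 = χ.compl p.1 ∧ χ.res p.1 = X ∧ χ.res p.2 = Y then matElem ρ p.1 p.2
      else 0 := by
  let φ : NetOp K S →L[ℂ] ℂ :=
    (innerSL ℂ (ket X)).comp (ContinuousLinearMap.apply ℂ (NetSpace K S) (ket Y))
  change φ (partialTrace χ ρ) = _
  rw [partialTrace, φ.map_tsum (hρ.summable_partialTraceTerm χ)]
  refine tsum_congr fun p => ?_
  change inner ℂ (ket X) (partialTraceTerm χ ρ p (ket Y)) = _
  rw [inner_partialTraceTerm]
  by_cases hX : χ.res p.1 = X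
  · by_cases hY : χ.res p.2 = Y
    · simp [hX, hY, ket_apply_self]
    · simp [hY, ket_apply_ne hY]
  · simp [hX, ket_apply_ne hX]

/-- The local operator `|Y⟩⟨X|` tensored with the identity of the complement; its expectation
values are the matrix elements of the partial trace. -/
theorem exists_local_matrixUnit [DecidableEq (NamedGraph K S)] (X Y : NamedGraph K S) :
    ∃ A : NetOp K S, IsLocal χ A ∧
      (∀ G H, matElem A H G ≠ 0 → χ.compl G = χ.compl H ∧ χ.res G = X ∧ χ.res H = Y) ∧
      ∀ ρ : NetOp K S, IsTraceClass ρ → opTrace (A * ρ) = matElem (partialTrace χ ρ) X Y := by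
  classical
  let D : Set (NamedGraph K S) :=
    {H | χ.res H = Y ∧ ∃ G, χ.res G = X ∧ χ.compl G = χ.compl H}
  have hex : ∀ H, ∃ G, H ∈ D → χ.res G = X ∧ χ.compl G = χ.compl H := by
    intro H
    by_cases h : H ∈ D
    · obtain ⟨G, hG⟩ := h.2
      exact ⟨G, fun _ => hG⟩
    · exact ⟨H, fun h' => absurd h' h⟩
  choose f hf using hex
  have hmem : ∀ {G H}, χ.compl H = χ.compl G ∧ χ.res G = X ∧ χ.res H = Y ↔ H ∈ D ∧ f H = G := by
    intro G H
    constructor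
    · rintro ⟨hc, hG, hH⟩
      have hD : H ∈ D := ⟨hH, G, hG, hc.symm⟩
      obtain ⟨h₁, h₂⟩ := hf H hD
      exact ⟨hD, χ.eq_of_res_eq_of_compl_eq (h₁.trans hG.symm) (h₂.trans hc)⟩
    · rintro ⟨hD, rfl⟩
      exact ⟨(hf H hD).2.symm, (hf H hD).1, hD.1⟩
  have hinj : Set.InjOn f D := by
    intro G hG H hH h
    refine χ.eq_of_res_eq_of_compl_eq (hG.1.trans hH.1.symm) ?_
    rw [← (hf G hG).2, ← (hf H hH).2, h]
  obtain ⟨A, hA⟩ := NetOp.exists_of_injOn D f hinj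
  have hmat : ∀ G H, matElem A H G =
      if χ.compl H = χ.compl G ∧ χ.res G = X ∧ χ.res H = Y then 1 else 0 := by
    intro G H
    rw [matElem_eq_apply, hA, if_congr hmem rfl rfl]
    by_cases hD : H ∈ D
    · by_cases hG : f H = G
      · simp [hD, hG, ket_apply_self]
      · simp [hD, hG, ket_apply_ne hG]
    · simp [hD]
  refine ⟨A, fun G H => ?_, fun G H h => ?_, fun ρ hρ => ?_⟩
  · rw [hmat, hmat, inner_ket_ket, χ.res_res, χ.res_res, χ.compl_res_eq H G]
    by_cases hc : χ.compl H = χ.compl G <;> simp [hc]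
  · rw [hmat] at h
    obtain ⟨hc, h⟩ := of_not_not fun h' => h (if_neg h')
    exact ⟨hc.symm, h⟩
  · rw [matElem_partialTrace χ hρ]
    have hg : Function.Injective fun G : NamedGraph K S => (f G, G) :=
      fun _ _ h => congrArg Prod.snd h
    rw [← hg.tsum_eq]
    · refine tsum_congr fun G => ?_
      rw [matElem_eq_apply, mul_apply_eq_comp, hA]
      simp only [hmem, and_true, matElem_eq_apply]
    · intro p hp
      have hp := of_not_not fun h' => hp (if_neg h')
      exact ⟨p.2, Prod.ext (hmem.1 hp).2 rfl⟩

theorem partialTrace_eq_of_local {ρ σ : NetOp K S} (hρ : IsTraceClass ρ) (hσ : IsTraceClass σ)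
    (h : ∀ A : NetOp K S, IsLocal χ A → opTrace (A * ρ) = opTrace (A * σ)) :
    partialTrace χ ρ = partialTrace χ σ := by
  classical
  refine NetOp.ext_matElem fun X Y => ?_
  obtain ⟨A, hA, -, htr⟩ := exists_local_matrixUnit χ X Y
  rw [← htr ρ hρ, ← htr σ hσ, h A hA]

/-- The partial trace of a name-preserving operator is name-preserving. -/
theorem NamePreserving.partialTrace {ρ : NetOp K S} (hn : NamePreserving ρ)
    (hρ : IsTraceClass ρ) : NamePreserving (partialTrace χ ρ) := by
  classical
  intro Y X hXY
  rw [matElem_partialTrace χ hρ]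
  refine (tsum_congr fun p => ?_).trans tsum_zero
  split_ifs with hp
  · obtain ⟨hc, rfl, rfl⟩ := hp
    exact hn _ _ (mt (χ.corresponds_support_iff hc).1 hXY)
  · rfl

theorem partialTrace_eq_of_local_of_namePreserving {ρ σ : NetOp K S} (hρ : IsTraceClass ρ)
    (hσ : IsTraceClass σ) (hnρ : NamePreserving ρ) (hnσ : NamePreserving σ)
    (h : ∀ A : NetOp K S, IsLocal χ A → NamePreserving A → opTrace (A * ρ) = opTrace (A * σ)) :
    partialTrace χ ρ = partialTrace χ σ := by
  classical
  refine NetOp.ext_matElem fun X Y => ?_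
  by_cases hXY : Name.Corresponds X.support Y.support
  · obtain ⟨A, hA, hsupp, htr⟩ := exists_local_matrixUnit χ X Y
    rw [← htr ρ hρ, ← htr σ hσ]
    refine h A hA fun G H hGH => by_contra fun hne => hGH ?_
    obtain ⟨hc, rfl, rfl⟩ := hsupp G H hne
    exact (χ.corresponds_support_iff hc).2 hXY
  · have hYX : ¬ Name.Corresponds Y.support X.support := fun h' => hXY h'.symm
    rw [hnρ.partialTrace χ hρ Y X hYX, hnσ.partialTrace χ hσ Y X hYX]

end Tomography

theorem mainTheorem7 {K S : Type*} [Countable K] (χ : Restriction K S) (ρ σ : NetOp K S)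
    (hρ : IsTraceClass ρ) (hσ : IsTraceClass σ) :
    -- the series that define `ρ_{|χ}` and `σ_{|χ}` converge
    (Summable (partialTraceTerm χ ρ) ∧ Summable (partialTraceTerm χ σ)) ∧
    -- local tomography
    ((∀ A : NetOp K S, IsLocal χ A → opTrace (A * ρ) = opTrace (A * σ)) →
      partialTrace χ ρ = partialTrace χ σ) ∧
    -- local tomography by name-preserving operators
    (NamePreserving ρ → NamePreserving σ →
      (∀ A : NetOp K S, IsLocal χ A → NamePreserving A →
        opTrace (A * ρ) = opTrace (A * σ)) →
      partialTrace χ ρ = partialTrace χ σ) :=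
  ⟨⟨hρ.summable_partialTraceTerm χ, hσ.summable_partialTraceTerm χ⟩,
    partialTrace_eq_of_local χ hρ hσ,
    partialTrace_eq_of_local_of_namePreserving χ hρ hσ⟩
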